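/- **Proposition 5.3 (Hölder continuity in the spatial variable).** Let $(\Omega,\mathcal F,(\mathcal F_t)_{t\ge 0},\mathbb P)$ be a filtered probability space and $W$ a standard real Brownian motion relative to $(\mathcal F_t)$ (that is, $W$ is adapted and $W(t)-W(s)$ is independent of $\mathcal F_s$ for $s\le t$). Let $a\le b$, $K=[a,b]$, $X=C([a,b])$, $T\ge 0$ and $t\in[0,T]$. An *elementary process* on $[0,T]$ is a process $x=\sum_{i=0}^n x_i\mathbf 1_{[t_i,t_{i+1})}$ with $0=t_0\le t_1\le\dots\le t_{n+1}=T$ and $x_i\in L^2((\Omega,\mathcal F_{t_i});X)$; its integral is $\int_0^t x\,dW=\sum_{i=0}^n x_i\,(W(t_{i+1}\wedge t)-W(t_i\wedge t))$. Let $\mathcal M_W$ be the completion of the space of elementary processes in the norm $\|x\|=\big\|\mathbb E\int_0^T x(s)^2\,ds\big\|_{C([a,b])}^{1/2}=\sup_{\sigma}\|x(\sigma)\|_{L^2([0,T]\times\Omega)}$, regarded as a closed subspace of $C([a,b];L^2([0,T]\times\Omega))$, and let $\mathcal M_t$ be the completion of $L^2((\Omega,\mathcal F_t);X)$ in the norm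 $\|\mathbb E[z^2]\|_{C([a,b])}^{1/2}$, regarded as a closed subspace of $C([a,b];L^2(\Omega))$. For $x\in\mathcal M_W$, the *Itô integral* $\int_0^t x\,dW$ is the element $z\in\mathcal M_t$ such that $\int_0^t x_n\,dW\to z$ in $\mathcal M_t$ for every sequence of elementary processes $x_n\to x$ in $\mathcal M_W$. Let $x\in\mathcal M_W$, and suppose that there are $\beta>\tfrac12$ and a random variable $L$ with $\mathbb E[L^2]<\infty$ such that, for all $\tau,\sigma\in[a,b]$, $$|x(\tau)(s,\omega)-x(\sigma)(s,\omega)|\le L(\omega)\,|\tau-\sigma|^\beta\qquad\text{for almost every }(s,\omega)\in[0,t]\times\Omega .$$ Then the Itô integral $z=\int_0^t x\,dW$ exists and is unique, and the random field $\sigma\mapsto z(\sigma)=\big(\int_0^t x\,dW\big)(\sigma)$ has a version that is Hölder continuous of every order $\gamma\in(0,\beta-\tfrac12)$: there are random variables $Y(\sigma)$, $\sigma\in[a,b]$, with $Y(\sigma)=z(\sigma)$ a.s. for each $\sigma$, such that for every $\gamma\in(0,\beta-\tfrac12)$ and every $\omega\in\Omega$ there is a $C<\infty$ with $|Y(\tau)(\omega)-Y(\sigma)(\omega)|\le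 C|\tau-\sigma|^\gamma$ for all $\tau,\sigma\in[a,b]$. -/

import Mathlib

open MeasureTheory ProbabilityTheory Filter Topology
open scoped NNReal ENNReal

namespace SpatialIto

section FieldEmbedding

variable {S K : Type*} [MeasurableSpace S] [MetricSpace K] [CompactSpace K]

theorem memLp_const_zero {E : Type*} [NormedAddCommGroup E] {μ : Measure S} :
    MemLp (fun _ : S => (0 : E)) 2 μ :=
  MemLp.zero'

theorem memLp_indicator_aux {E : Type*} [NormedAddCommGroup E] {μ : Measure S} {A : Set S}
    (hA : MeasurableSet A) {f : S → E} (hf : MemLp f 2 μ) : MemLp (A.indicator f) 2 μ :=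
  hf.indicator hA

theorem memLp_sum_aux {E ι : Type*} [NormedAddCommGroup E] [Fintype ι] {μ : Measure S}
    {f : ι → S → E} (hf : ∀ i, MemLp (f i) 2 μ) : MemLp (fun s => ∑ i, f i s) 2 μ :=
  memLp_finsetSum Finset.univ fun i _ => hf i

theorem memLp_eval {μ : Measure S} {f : S → C(K, ℝ)} (hf : MemLp f 2 μ) (k : K) :
    MemLp (fun s => f s k) 2 μ :=
  (ContinuousMap.evalCLM ℝ k : C(K, ℝ) →L[ℝ] ℝ).comp_memLp' hf

theorem norm_sq_toLp {μ : Measure S} {g : S → ℝ} (hg : MemLp g 2 μ) :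
    ‖hg.toLp g‖ ^ 2 = ∫ s, g s * g s ∂μ := by
  rw [← real_inner_self_eq_norm_sq, L2.inner_def]
  refine integral_congr_ae ?_
  filter_upwards [hg.coeFn_toLp] with s hs
  simp [hs, pow_two]

/-- The embedding of `L²(S; C(K))` into `C(K; L²(S))` by change of the order of the variables:
`f` is sent to `k ↦ [s ↦ f s k]`. -/
noncomputable def toField {μ : Measure S} (f : S → C(K, ℝ)) (hf : MemLp f 2 μ) :
    C(K, Lp ℝ 2 μ) where
  toFun k := (memLp_eval hf k).toLp (fun s => f s k)
  continuous_toFun := by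
    rw [continuous_iff_continuousAt]
    intro l
    have hsub : ∀ k, MemLp (fun s => f s k - f s l) 2 μ := fun k =>
      (memLp_eval hf k).sub (memLp_eval hf l)
    have hI : Continuous (fun k => ∫ s, (f s k - f s l) * (f s k - f s l) ∂μ) := by
      refine continuous_of_dominated (bound := fun s => 4 * ‖f s‖ ^ 2) ?_ ?_ ?_ ?_
      · intro k
        exact (hsub k).1.mul (hsub k).1
      · intro k
        refine Eventually.of_forall fun s => ?_
        have h1 := (f s).norm_coe_le_norm k
        have h2 := (f s).norm_coe_le_norm l
        have h3 : ‖f s k - f s l‖ ≤ 2 * ‖f s‖ := (norm_sub_le _ _).trans (by linarith)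
        rw [norm_mul]
        nlinarith [norm_nonneg (f s k - f s l), norm_nonneg (f s)]
      · exact (hf.integrable_norm_pow (by norm_num)).const_mul 4
      · refine Eventually.of_forall fun s => ?_
        fun_prop
    have h0 := hI.tendsto l
    simp only [sub_self, mul_zero, integral_zero] at h0
    rw [ContinuousAt, tendsto_iff_norm_sub_tendsto_zero]
    have h1 := (Real.continuous_sqrt.tendsto 0).comp h0
    rw [Real.sqrt_zero] at h1
    refine h1.congr fun k => ?_
    rw [← MemLp.toLp_sub]
    have h2 := norm_sq_toLp (hsub k)
    simp only [Function.comp]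
    rw [← h2, Real.sqrt_sq (norm_nonneg _)]
    rfl

/-- The supremum norm of `C(K; L²(S))` restricts, on `L²(S; C(K))`, to the norm
`‖∫ f² dμ‖ ^ (1/2)` taken in `C(K)`. Hence the completion of a subspace of `L²(S; C(K))` with
respect to that norm is its closure in the complete space `C(K; L²(S))`. -/
theorem norm_toField_sq {μ : Measure S} (f : S → C(K, ℝ)) (hf : MemLp f 2 μ) :
    ‖toField f hf‖ ^ 2 = ‖∫ s, f s * f s ∂μ‖ := by
  have hint : Integrable (fun s => f s * f s) μ := by
    refine (hf.integrable_norm_pow (by norm_num)).mono' (hf.1.mul hf.1) ?_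
    refine Eventually.of_forall fun s => ?_
    rw [pow_two]
    exact norm_mul_le _ _
  have hk : ∀ k, ‖toField f hf k‖ ^ 2 = ‖(∫ s, f s * f s ∂μ) k‖ := by
    intro k
    rw [ContinuousMap.integral_apply hint]
    change ‖(memLp_eval hf k).toLp (fun s => f s k)‖ ^ 2 = _
    rw [norm_sq_toLp, Real.norm_of_nonneg]
    · rfl
    · exact integral_nonneg fun s => mul_self_nonneg _
  apply le_antisymm
  · rw [← Real.le_sqrt (norm_nonneg _) (norm_nonneg _),
      ContinuousMap.norm_le _ (Real.sqrt_nonneg _)]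
    intro k
    rw [Real.le_sqrt (norm_nonneg _) (norm_nonneg _), hk]
    exact ContinuousMap.norm_coe_le_norm _ k
  · rw [ContinuousMap.norm_le _ (by positivity)]
    intro k
    rw [← hk]
    gcongr
    exact ContinuousMap.norm_coe_le_norm _ k

end FieldEmbedding

section Integral

variable {Ω : Type*} [mΩ : MeasurableSpace Ω]

/-- `W` is a standard real Brownian motion relative to the filtration `ℱ`: it is a Brownian motion,
it is adapted to `ℱ`, and its increments after time `s` are independent of `ℱ s`. -/
structure IsBrownianMotion (W : ℝ≥0 → Ω → ℝ) (ℱ : Filtration ℝ≥0 mΩ) (P : Measure Ω) : Prop where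
  isBrownianReal : IsBrownianReal W P
  adapted : StronglyAdapted ℱ W
  indep_increment : ∀ s t : ℝ≥0, s ≤ t →
    Indep (MeasurableSpace.comap (fun ω => W t ω - W s ω) inferInstance) (ℱ s) P

/-- The measure `ds ⊗ P` on `[0,T] × Ω`. -/
noncomputable def timeProd (T : ℝ≥0) (P : Measure Ω) : Measure (ℝ × Ω) :=
  ((volume : Measure ℝ).restrict (Set.Icc 0 (T : ℝ))).prod P

/-- An elementary `C(K)`-valued process `∑ i, x_i 1_[t_i, t_(i+1))` on `[0,T]`, where
`0 = t_0 ≤ ⋯ ≤ t_(n+1) = T` and `x_i ∈ L²((Ω, ℱ t_i); C(K))`. -/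
structure ElementaryProcess (K : Type*) [MetricSpace K] [CompactSpace K]
    (ℱ : Filtration ℝ≥0 mΩ) (P : Measure Ω) (T : ℝ≥0) where
  n : ℕ
  time : Fin (n + 2) → ℝ≥0
  time_mono : Monotone time
  time_zero : time 0 = 0
  time_last : time (Fin.last (n + 1)) = T
  coeff : Fin (n + 1) → Ω → C(K, ℝ)
  coeff_meas : ∀ i, StronglyMeasurable[ℱ (time i.castSucc)] (coeff i)
  coeff_memLp : ∀ i, MemLp (coeff i) 2 P

namespace ElementaryProcess

variable {K : Type*} [MetricSpace K] [CompactSpace K]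
  {ℱ : Filtration ℝ≥0 mΩ} {P : Measure Ω} {T : ℝ≥0}

/-- The process as a function of `(s, ω)`. -/
noncomputable def toFun (u : ElementaryProcess K ℱ P T) (p : ℝ × Ω) : C(K, ℝ) :=
  ∑ i : Fin (u.n + 1),
    (Set.Ico (u.time i.castSucc : ℝ) (u.time i.succ)).indicator (fun _ => u.coeff i p.2) p.1

theorem memLp_toFun [IsProbabilityMeasure P] (u : ElementaryProcess K ℱ P T) :
    MemLp u.toFun 2 (timeProd T P) := by
  have h : ∀ i ∈ (Finset.univ : Finset (Fin (u.n + 1))),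
      MemLp (fun p : ℝ × Ω => (Set.Ico (u.time i.castSucc : ℝ) (u.time i.succ)).indicator
        (fun _ => u.coeff i p.2) p.1) 2 (timeProd T P) := by
    intro i _
    have h1 : MemLp (fun p : ℝ × Ω => u.coeff i p.2) 2 (timeProd T P) :=
      (u.coeff_memLp i).comp_snd ((volume : Measure ℝ).restrict (Set.Icc 0 (T : ℝ)))
    have hs : MeasurableSet
        ((Prod.fst : ℝ × Ω → ℝ) ⁻¹' Set.Ico (u.time i.castSucc : ℝ) (u.time i.succ)) :=
      measurable_fst measurableSet_Ico
    have h2 := memLp_indicator_aux hs h1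
    have he : (fun p : ℝ × Ω => (Set.Ico (u.time i.castSucc : ℝ) (u.time i.succ)).indicator
        (fun _ => u.coeff i p.2) p.1) =
        ((Prod.fst : ℝ × Ω → ℝ) ⁻¹' Set.Ico (u.time i.castSucc : ℝ) (u.time i.succ)).indicator
          (fun p : ℝ × Ω => u.coeff i p.2) := by
      funext p
      by_cases hp : p.1 ∈ Set.Ico (u.time i.castSucc : ℝ) (u.time i.succ)
      · rw [Set.indicator_of_mem hp, Set.indicator_of_mem (s := Prod.fst ⁻¹' _) hp]
      · rw [Set.indicator_of_notMem hp, Set.indicator_of_notMem (s := Prod.fst ⁻¹' _) hp]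
    rw [he]
    exact h2
  exact memLp_sum_aux fun i => h i (Finset.mem_univ i)

/-- The stochastic integral `∑ i, x_i (W (t_(i+1) ∧ t) - W (t_i ∧ t))` of an elementary process. -/
noncomputable def integralFun (u : ElementaryProcess K ℱ P T) (W : ℝ≥0 → Ω → ℝ) (t : ℝ≥0)
    (ω : Ω) : C(K, ℝ) :=
  ∑ i : Fin (u.n + 1),
    (W (min (u.time i.succ) t) ω - W (min (u.time i.castSucc) t) ω) • u.coeff i ω

theorem memLp_integralFun {W : ℝ≥0 → Ω → ℝ} (hW : IsBrownianMotion W ℱ P)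
    (u : ElementaryProcess K ℱ P T) (t : ℝ≥0) : MemLp (u.integralFun W t) 2 P := by
  unfold integralFun
  refine memLp_sum_aux fun i => ?_
  have hle : u.time i.castSucc ≤ u.time i.succ := u.time_mono (Fin.castSucc_le_succ i)
  rcases le_total t (u.time i.castSucc) with h | h
  · rw [min_eq_right h, min_eq_right (h.trans hle)]
    simp only [sub_self, zero_smul]
    exact memLp_const_zero
  · rw [min_eq_left h]
    have hst : u.time i.castSucc ≤ min (u.time i.succ) t := le_min hle h
    have hD : MemLp (fun ω => W (min (u.time i.succ) t) ω - W (u.time i.castSucc) ω) 2 P :=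
      (hW.isBrownianReal.isGaussianProcess.hasGaussianLaw_eval _).memLp_two.sub
        (hW.isBrownianReal.isGaussianProcess.hasGaussianLaw_eval _).memLp_two
    have hX := u.coeff_memLp i
    have hXm := u.coeff_meas i
    have hind : IndepFun (fun ω => W (min (u.time i.succ) t) ω - W (u.time i.castSucc) ω)
        (fun ω => ‖u.coeff i ω‖) P := by
      rw [IndepFun_iff_Indep]
      exact indep_of_indep_of_le_right (hW.indep_increment _ _ hst)
        hXm.norm.measurable.comap_le
    have hind2 := hind.comp (φ := fun r : ℝ => r ^ 2) (ψ := fun r : ℝ => r ^ 2)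
      (by fun_prop) (by fun_prop)
    have hint := hind2.integrable_mul hD.integrable_sq
      (hX.integrable_norm_pow (by norm_num))
    refine (memLp_two_iff_integrable_sq_norm (hD.1.smul hX.1)).2 (hint.congr ?_)
    refine Eventually.of_forall fun ω => ?_
    simp [norm_smul, mul_pow]

/-- An elementary process as an element of `C(K; L²([0,T] × Ω))`. -/
noncomputable def field [IsProbabilityMeasure P] (u : ElementaryProcess K ℱ P T) :
    C(K, Lp ℝ 2 (timeProd T P)) :=
  toField u.toFun u.memLp_toFun

/-- The stochastic integral over `[0,t]` of an elementary process, as an element of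
`C(K; L²(Ω))`. -/
noncomputable def integral {W : ℝ≥0 → Ω → ℝ} (hW : IsBrownianMotion W ℱ P)
    (u : ElementaryProcess K ℱ P T) (t : ℝ≥0) : C(K, Lp ℝ 2 P) :=
  toField (u.integralFun W t) (u.memLp_integralFun hW t)

end ElementaryProcess

/-- The space of stochastically integrable `C(K)`-valued functions on `[0,T] × Ω`: the completion
of the elementary processes in the norm `‖E ∫_0^T x(s)² ds‖ ^ (1/2)` taken in `C(K)`, realised as a
closure in `C(K; L²([0,T] × Ω))`, whose norm restricts to it by `norm_toField_sq`. -/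
def integrands (K : Type*) [MetricSpace K] [CompactSpace K] (ℱ : Filtration ℝ≥0 mΩ)
    (P : Measure Ω) [IsProbabilityMeasure P] (T : ℝ≥0) : Set C(K, Lp ℝ 2 (timeProd T P)) :=
  closure (Set.range fun u : ElementaryProcess K ℱ P T => u.field)

/-- The completion of `L²((Ω, ℱ t); C(K))` in the norm `‖E x²‖ ^ (1/2)` taken in `C(K)`, realised
as a closure in `C(K; L²(Ω))`. -/
def integralSpace (K : Type*) [MetricSpace K] [CompactSpace K] (ℱ : Filtration ℝ≥0 mΩ)
    (P : Measure Ω) (t : ℝ≥0) : Set C(K, Lp ℝ 2 P) :=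
  closure {z | ∃ (f : Ω → C(K, ℝ)) (hf : MemLp f 2 P),
    StronglyMeasurable[ℱ t] f ∧ z = toField f hf}

/-- `z` is the Itô integral `∫_0^t x(s) dW(s)` of the integrand `x`: the integrals over `[0,t]` of
any elementary processes that converge to `x` converge to `z`. -/
structure IsItoIntegral {K : Type*} [MetricSpace K] [CompactSpace K] {ℱ : Filtration ℝ≥0 mΩ}
    {P : Measure Ω} [IsProbabilityMeasure P] {W : ℝ≥0 → Ω → ℝ} (hW : IsBrownianMotion W ℱ P)
    {T : ℝ≥0} (x : C(K, Lp ℝ 2 (timeProd T P))) (t : ℝ≥0) (z : C(K, Lp ℝ 2 P)) : Prop where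
  mem_integrands : x ∈ integrands K ℱ P T
  mem_integralSpace : z ∈ integralSpace K ℱ P t
  tendsto_integral : ∀ u : ℕ → ElementaryProcess K ℱ P T,
    Tendsto (fun n => (u n).field) atTop (𝓝 x) →
    Tendsto (fun n => (u n).integral hW t) atTop (𝓝 z)

end Integral

end SpatialIto

/-! Integration preserves spatial increments in mean square. For elementary processes, independence
of Brownian increments from the past makes the `L²(Ω)` inner product of two integrals over `[0,t]`,
each evaluated at its own point of `K`, equal to the `L²([0,t] × Ω)` inner product of the integrands
at those points (`inner_integral_integral`). Taking the same point twice shows that integration is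
nonexpansive for the supremum norms, so it extends to the closure and the limit does not depend on
the approximating sequence (`exists_isItoIntegral`, `IsItoIntegral.unique`). Taking one process at
two points and passing to the limit gives `‖z τ - z σ‖ = ‖x τ - x σ‖`, the right-hand norm being
over `[0,t] × Ω`.

The pathwise bound on `x` then yields `E|z τ - z σ|² ≤ t E[L²] |τ - σ|^(2β)`
(`enorm_restrictTime_sub_le`). As `2β = 1 + (2β - 1)`, the Kolmogorov–Chentsov criterion with second
moments gives every Hölder order below `(2β - 1)/2 = β - 1/2` (`exists_holder_version`). That
criterion is proved by summing the weighted squares of all dyadic increments and chaining along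
binary expansions. -/

namespace SpatialIto

/-! ### Deterministic dyadic chaining. -/

section Chaining

/-- Refining the grid appends one binary digit, so the dyadic approximation of a point either stays
put or moves to its right neighbour on the finer grid. -/
theorem floor_two_mul_cases {y : ℝ} (hy : 0 ≤ y) :
    ⌊2 * y⌋₊ = 2 * ⌊y⌋₊ ∨ ⌊2 * y⌋₊ = 2 * ⌊y⌋₊ + 1 := by
  have h1 := Nat.floor_le hy
  have h2 := Nat.lt_floor_add_one y
  have h3 : 2 * ⌊y⌋₊ ≤ ⌊2 * y⌋₊ := Nat.le_floor (by push_cast; linarith)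
  have h4 : ⌊2 * y⌋₊ < 2 * ⌊y⌋₊ + 2 := (Nat.floor_lt (by positivity)).2 (by push_cast; linarith)
  omega

theorem floor_mul_two_pow_lt {y : ℝ} (hy : y ∈ Set.Ico (0 : ℝ) 1) (n : ℕ) :
    ⌊y * 2 ^ n⌋₊ < 2 ^ n := by
  rw [Nat.floor_lt (mul_nonneg hy.1 (by positivity))]
  push_cast
  exact mul_lt_of_lt_one_left (by positivity) hy.2

/-- One step of the dyadic chain through values `F n k` attached to the points `k / 2 ^ n`. -/
theorem abs_sub_dyadic_step_le {F : ℕ → ℕ → ℝ} (hF : ∀ n k, F (n + 1) (2 * k) = F n k)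
    {A ρ : ℝ} (hA : 0 ≤ A) (hρ : 0 ≤ ρ)
    (hinc : ∀ n k, k < 2 ^ n → |F n (k + 1) - F n k| ≤ A * ρ ^ n)
    {y : ℝ} (hy : y ∈ Set.Ico (0 : ℝ) 1) (n : ℕ) :
    |F (n + 1) ⌊y * 2 ^ (n + 1)⌋₊ - F n ⌊y * 2 ^ n⌋₊| ≤ A * ρ * ρ ^ n := by
  have h := floor_two_mul_cases (y := y * 2 ^ n) (mul_nonneg hy.1 (by positivity))
  have he : y * 2 ^ (n + 1) = 2 * (y * 2 ^ n) := by ring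
  rw [he, ← hF n ⌊y * 2 ^ n⌋₊]
  rcases h with h | h
  · rw [h, sub_self, abs_zero]
    positivity
  · have hk : 2 * ⌊y * 2 ^ n⌋₊ < 2 ^ (n + 1) := by
      have := floor_mul_two_pow_lt hy n
      rw [pow_succ]
      omega
    rw [h]
    refine (hinc (n + 1) _ hk).trans (le_of_eq ?_)
    ring

theorem exists_dyadic_scale {r : ℝ} (h0 : 0 < r) (h1 : r ≤ 1) :
    ∃ n : ℕ, ((1 : ℝ) / 2) ^ (n + 1) < r ∧ r ≤ (1 / 2) ^ n :=
  exists_nat_pow_near_of_lt_one h0 h1 (by norm_num) (by norm_num)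

/-- Dyadic chaining: if the increments of level `n` are at most `A (2 ^ (-γ)) ^ n`, the values along
the dyadic floors of `y` converge, and the limit is Hölder continuous of order `γ` in `y`. -/
theorem exists_holder_limit_of_dyadic_increments {F : ℕ → ℕ → ℝ}
    (hF : ∀ n k, F (n + 1) (2 * k) = F n k) {A γ : ℝ} (hA : 0 ≤ A) (hγ : 0 < γ)
    (hinc : ∀ n k, k < 2 ^ n → |F n (k + 1) - F n k| ≤ A * ((1 / 2 : ℝ) ^ γ) ^ n) :
    ∃ (g : ℝ → ℝ) (C : ℝ), 0 ≤ C ∧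
      (∀ y ∈ Set.Ico (0 : ℝ) 1, Tendsto (fun n => F n ⌊y * 2 ^ n⌋₊) atTop (𝓝 (g y))) ∧
      ∀ y ∈ Set.Ico (0 : ℝ) 1, ∀ w ∈ Set.Ico (0 : ℝ) 1, |g y - g w| ≤ C * |y - w| ^ γ := by
  set ρ : ℝ := (1 / 2 : ℝ) ^ γ with hρdef
  have hρ0 : 0 < ρ := Real.rpow_pos_of_pos (by norm_num) _
  have hρ1 : ρ < 1 := Real.rpow_lt_one (by norm_num) (by norm_num) hγ
  have hstep : ∀ y ∈ Set.Ico (0 : ℝ) 1, ∀ n,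
      dist (F n ⌊y * 2 ^ n⌋₊) (F (n + 1) ⌊y * 2 ^ (n + 1)⌋₊) ≤ A * ρ * ρ ^ n := by
    intro y hy n
    rw [dist_comm, Real.dist_eq]
    exact abs_sub_dyadic_step_le hF hA hρ0.le hinc hy n
  -- The membership condition sits under the existential so that `choose` returns a function on all
  -- of `ℝ`; the value outside `[0,1)` is irrelevant.
  have hlim : ∀ y, ∃ l, y ∈ Set.Ico (0 : ℝ) 1 →
      Tendsto (fun n => F n ⌊y * 2 ^ n⌋₊) atTop (𝓝 l) := by
    intro y
    by_cases hy : y ∈ Set.Ico (0 : ℝ) 1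
    · obtain ⟨l, hl⟩ := cauchySeq_tendsto_of_complete
        (cauchySeq_of_le_geometric ρ (A * ρ) hρ1 (hstep y hy))
      exact ⟨l, fun _ => hl⟩
    · exact ⟨0, fun h => absurd h hy⟩
  choose g hg using hlim
  have htail : ∀ y ∈ Set.Ico (0 : ℝ) 1, ∀ n,
      |F n ⌊y * 2 ^ n⌋₊ - g y| ≤ A * ρ * ρ ^ n / (1 - ρ) := by
    intro y hy n
    rw [← Real.dist_eq]
    exact dist_le_of_le_geometric_of_tendsto ρ (A * ρ) hρ1 (hstep y hy) (hg y hy) n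
  have h1ρ : 0 < 1 - ρ := by linarith
  -- Points at distance at most one mesh width have equal or adjacent floors, so at most one grid
  -- increment separates them.
  have hfloor : ∀ y ∈ Set.Ico (0 : ℝ) 1, ∀ w ∈ Set.Ico (0 : ℝ) 1, y < w → ∀ n : ℕ,
      w - y ≤ (1 / 2) ^ n → |F n ⌊w * 2 ^ n⌋₊ - F n ⌊y * 2 ^ n⌋₊| ≤ A * ρ ^ n := by
    intro y hy w hw hyw n hn
    have h2 : (0 : ℝ) < 2 ^ n := by positivity
    have hle : ⌊y * 2 ^ n⌋₊ ≤ ⌊w * 2 ^ n⌋₊ := Nat.floor_mono (by gcongr)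
    have hmul : w * 2 ^ n ≤ y * 2 ^ n + 1 := by
      have h3 := mul_le_mul_of_nonneg_right hn h2.le
      rw [← mul_pow] at h3
      norm_num at h3
      linarith
    have hle2 : ⌊w * 2 ^ n⌋₊ ≤ ⌊y * 2 ^ n⌋₊ + 1 := by
      rw [← Nat.floor_add_one (mul_nonneg hy.1 h2.le)]
      exact Nat.floor_mono hmul
    have hlt := floor_mul_two_pow_lt hy n
    rcases (show ⌊w * 2 ^ n⌋₊ = ⌊y * 2 ^ n⌋₊ ∨ ⌊w * 2 ^ n⌋₊ = ⌊y * 2 ^ n⌋₊ + 1 by omega)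
      with h | h
    · rw [h, sub_self, abs_zero]
      positivity
    · rw [h]
      exact hinc n _ hlt
  -- One grid increment plus the two geometric tails from level `n` to the limits.
  set c : ℝ := A + 2 * (A * ρ / (1 - ρ)) with hc
  have hc0 : 0 ≤ c := by positivity
  have hmain : ∀ y ∈ Set.Ico (0 : ℝ) 1, ∀ w ∈ Set.Ico (0 : ℝ) 1, y < w →
      |g y - g w| ≤ c / ρ * |y - w| ^ γ := by
    intro y hy w hw hyw
    have hr0 : 0 < w - y := by linarith
    obtain ⟨n, hn1, hn2⟩ := exists_dyadic_scale hr0 (by linarith [hy.1, hw.2])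
    have h1 := htail y hy n
    have h2 := htail w hw n
    have h3 := hfloor y hy w hw hyw n hn2
    have h4 : |g y - g w| ≤ c * ρ ^ n := by
      have h5 : g y - g w = -(F n ⌊y * 2 ^ n⌋₊ - g y) - (F n ⌊w * 2 ^ n⌋₊ - F n ⌊y * 2 ^ n⌋₊) +
          (F n ⌊w * 2 ^ n⌋₊ - g w) := by ring
      have h6 : c * ρ ^ n = A * ρ * ρ ^ n / (1 - ρ) + A * ρ ^ n + A * ρ * ρ ^ n / (1 - ρ) := by
        rw [hc]; ring
      rw [abs_le] at *
      constructor <;> linarith [h1.1, h1.2, h2.1, h2.2, h3.1, h3.2]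
    refine h4.trans ?_
    -- The lower bound on `w - y` is at scale `n + 1`, so only `ρ ^ (n + 1)` is controlled by `|y -
    -- w| ^ γ`; this costs the factor `1 / ρ`.
    rw [div_mul_eq_mul_div, le_div_iff₀ hρ0, mul_assoc, ← pow_succ]
    gcongr
    rw [abs_sub_comm, abs_of_pos hr0, hρdef, ← Real.rpow_natCast, ← Real.rpow_mul (by norm_num),
      mul_comm, Real.rpow_mul (by norm_num), Real.rpow_natCast]
    gcongr
  refine ⟨g, c / ρ, by positivity, fun y hy => hg y hy, fun y hy w hw => ?_⟩
  rcases lt_trichotomy y w with h | h | h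
  · exact hmain y hy w hw h
  · subst h
    rw [sub_self, abs_zero]
    positivity
  · rw [abs_sub_comm, abs_sub_comm y w]
    exact hmain w hw y hy h

end Chaining

/-! ### The Kolmogorov–Chentsov criterion on a compact interval. -/

section Kolmogorov

variable {Ω : Type*} [mΩ : MeasurableSpace Ω]

/-- The points `a + k D / 2 ^ n` of the dyadic grid of mesh `D / 2 ^ n`, projected to `[a, b]`. -/
noncomputable def gridPoint {a b : ℝ} (hab : a ≤ b) (D : ℝ) (n k : ℕ) : Set.Icc a b :=
  Set.projIcc a b hab (a + D * (k / 2 ^ n))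

theorem gridPoint_succ_two_mul {a b : ℝ} (hab : a ≤ b) (D : ℝ) (n k : ℕ) :
    gridPoint hab D (n + 1) (2 * k) = gridPoint hab D n k := by
  unfold gridPoint
  congr 3
  push_cast
  rw [pow_succ, mul_comm (2 : ℝ) k, mul_div_mul_right _ _ two_ne_zero]

theorem abs_projIcc_sub_projIcc_le {a b : ℝ} (hab : a ≤ b) (c d : ℝ) :
    |(Set.projIcc a b hab c : ℝ) - Set.projIcc a b hab d| ≤ |c - d| :=
  Set.abs_projIcc_sub_projIcc hab

theorem abs_gridPoint_succ_sub_le {a b : ℝ} (hab : a ≤ b) {D : ℝ} (hD : 0 ≤ D) (n k : ℕ) :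
    |(gridPoint hab D n (k + 1) : ℝ) - gridPoint hab D n k| ≤ D * (1 / 2) ^ n := by
  refine (abs_projIcc_sub_projIcc_le hab _ _).trans (le_of_eq ?_)
  rw [show a + D * (((k + 1 : ℕ) : ℝ) / 2 ^ n) - (a + D * ((k : ℝ) / 2 ^ n)) = D * (1 / 2) ^ n by
    push_cast; rw [div_pow, one_pow]; ring]
  exact abs_of_nonneg (by positivity)

theorem tendsto_gridPoint_floor {a b : ℝ} (hab : a ≤ b) {D : ℝ} (hD : 0 < D) (σ : Set.Icc a b) :
    Tendsto (fun n : ℕ => gridPoint hab D n ⌊((σ : ℝ) - a) / D * 2 ^ n⌋₊) atTop (𝓝 σ) := by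
  have h1 : Tendsto (fun n : ℕ => (⌊((σ : ℝ) - a) / D * 2 ^ n⌋₊ : ℝ) / 2 ^ n) atTop
      (𝓝 (((σ : ℝ) - a) / D)) :=
    (tendsto_nat_floor_mul_div_atTop (div_nonneg (sub_nonneg.2 σ.2.1) hD.le)).comp
      (tendsto_pow_atTop_atTop_of_one_lt (one_lt_two : (1 : ℝ) < 2))
  have h2 := ((continuous_projIcc (h := hab)).tendsto _).comp ((h1.const_mul D).const_add a)
  rw [mul_div_cancel₀ _ hD.ne', add_sub_cancel, Set.projIcc_val] at h2
  exact h2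

/-- Almost sure control of all dyadic increments of a process with the Kolmogorov moment bound. -/
theorem ae_exists_dyadic_increment_bound {P : Measure Ω} {a b : ℝ} (hab : a ≤ b)
    {X : Set.Icc a b → Ω → ℝ} (hX : ∀ σ, Measurable (X σ)) {M : ℝ≥0} {β : ℝ} (hβ : 0 < β)
    (hmom : ∀ τ σ, ∫⁻ ω, ‖X τ ω - X σ ω‖ₑ ^ 2 ∂P ≤
      M * ENNReal.ofReal (|(τ : ℝ) - σ| ^ β) ^ 2)
    {D : ℝ} (hD : 0 < D) {γ : ℝ} (hγ : γ < β - 1 / 2) :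
    ∀ᵐ ω ∂P, ∃ A : ℝ, 0 ≤ A ∧ ∀ n k, k < 2 ^ n →
      |X (gridPoint hab D n (k + 1)) ω - X (gridPoint hab D n k) ω| ≤
        A * ((1 / 2 : ℝ) ^ γ) ^ n := by
  set ρ : ℝ := (1 / 2 : ℝ) ^ γ with hρ
  have hρ0 : 0 < ρ := Real.rpow_pos_of_pos (by norm_num) _
  -- If this sum is finite, each of its terms is bounded by it, which is the required bound with `A
  -- = √S`. Finiteness almost surely follows from a finite expectation.
  let S : Ω → ℝ≥0∞ := fun ω => ∑' n : ℕ, ∑ k ∈ Finset.range (2 ^ n),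
    ENNReal.ofReal ((ρ ^ n)⁻¹) ^ 2 *
      ‖X (gridPoint hab D n (k + 1)) ω - X (gridPoint hab D n k) ω‖ₑ ^ 2
  have hmeas : ∀ n k, Measurable fun ω =>
      ‖X (gridPoint hab D n (k + 1)) ω - X (gridPoint hab D n k) ω‖ₑ ^ 2 := fun n k =>
    (((hX _).sub (hX _)).enorm).pow_const 2
  have hSm : Measurable S := by
    refine Measurable.tsum fun n => Finset.measurable_sum _ fun k _ => ?_
    exact (hmeas n k).const_mul _
  -- The geometric ratio of the level sums: there are `2 ^ n` increments at level `n`, hence the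
  -- factor `2`. Here `q = 2 ^ (1 - 2(β - γ))`, which is below `1` exactly when `γ < β - 1/2`.
  set q : ℝ := 2 * ((1 / 2 : ℝ) ^ β / ρ) ^ 2 with hq
  have hq0 : 0 ≤ q := by positivity
  have hq1 : q < 1 := by
    rw [hq, hρ, ← Real.rpow_sub (by norm_num), ← Real.rpow_natCast, ← Real.rpow_mul (by norm_num)]
    have h1 : ((1 : ℝ) / 2) ^ ((β - γ) * ((2 : ℕ) : ℝ)) < (1 / 2) ^ (1 : ℝ) :=
      Real.rpow_lt_rpow_of_exponent_gt (by norm_num) (by norm_num) (by push_cast; linarith)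
    rw [Real.rpow_one] at h1
    linarith
  have hterm : ∀ n k, ∫⁻ ω, ENNReal.ofReal ((ρ ^ n)⁻¹) ^ 2 *
      ‖X (gridPoint hab D n (k + 1)) ω - X (gridPoint hab D n k) ω‖ₑ ^ 2 ∂P ≤
      M * ENNReal.ofReal ((D ^ β) ^ 2 * (((1 / 2 : ℝ) ^ β / ρ) ^ 2) ^ n) := by
    intro n k
    rw [lintegral_const_mul _ (hmeas n k)]
    have h1 : |(gridPoint hab D n (k + 1) : ℝ) - gridPoint hab D n k| ^ β ≤
        D ^ β * ((1 / 2 : ℝ) ^ β) ^ n := by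
      refine (Real.rpow_le_rpow (abs_nonneg _) (abs_gridPoint_succ_sub_le hab hD.le n k)
        hβ.le).trans (le_of_eq ?_)
      rw [Real.mul_rpow hD.le (by positivity), ← Real.rpow_natCast, ← Real.rpow_natCast,
        ← Real.rpow_mul (by norm_num), ← Real.rpow_mul (by norm_num), mul_comm (n : ℝ)]
    calc ENNReal.ofReal ((ρ ^ n)⁻¹) ^ 2 * ∫⁻ ω,
          ‖X (gridPoint hab D n (k + 1)) ω - X (gridPoint hab D n k) ω‖ₑ ^ 2 ∂P
        ≤ ENNReal.ofReal ((ρ ^ n)⁻¹) ^ 2 *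
          (M * ENNReal.ofReal (D ^ β * ((1 / 2 : ℝ) ^ β) ^ n) ^ 2) := by
          gcongr
          exact (hmom _ _).trans (by gcongr)
      _ = M * (ENNReal.ofReal ((ρ ^ n)⁻¹) ^ 2 *
          ENNReal.ofReal (D ^ β * ((1 / 2 : ℝ) ^ β) ^ n) ^ 2) := by ring
      _ = _ := by
          rw [← ENNReal.ofReal_pow (by positivity), ← ENNReal.ofReal_pow (by positivity),
            ← ENNReal.ofReal_mul (by positivity)]
          congr 2
          rw [← pow_mul, mul_comm 2 n, pow_mul, div_pow]
          field_simp
  have hSint : ∫⁻ ω, S ω ∂P ≠ ∞ := by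
    have hle : ∫⁻ ω, S ω ∂P ≤ ∑' n : ℕ, M * ENNReal.ofReal ((D ^ β) ^ 2 * q ^ n) := by
      rw [lintegral_tsum fun n => (Finset.measurable_sum _ fun k _ =>
        (hmeas n k).const_mul _).aemeasurable]
      refine ENNReal.tsum_le_tsum fun n => ?_
      rw [lintegral_finsetSum _ fun k _ => (hmeas n k).const_mul _]
      refine (Finset.sum_le_sum fun k _ => hterm n k).trans (le_of_eq ?_)
      rw [Finset.sum_const, Finset.card_range, nsmul_eq_mul, hq, mul_pow, mul_left_comm]
      congr 1
      rw [show ((2 ^ n : ℕ) : ℝ≥0∞) = ENNReal.ofReal (2 ^ n) by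
          rw [ENNReal.ofReal_pow (by norm_num)]; simp,
        ← ENNReal.ofReal_mul (by positivity)]
      congr 1
      ring
    refine ne_top_of_le_ne_top ?_ hle
    rw [ENNReal.tsum_mul_left]
    refine ENNReal.mul_ne_top ENNReal.coe_ne_top ?_
    exact ((summable_geometric_of_lt_one hq0 hq1).mul_left _).tsum_ofReal_ne_top
  filter_upwards [ae_lt_top hSm hSint] with ω hω
  refine ⟨√(S ω).toReal, Real.sqrt_nonneg _, fun n k hk => ?_⟩
  have h1 : ENNReal.ofReal ((ρ ^ n)⁻¹) ^ 2 *
      ‖X (gridPoint hab D n (k + 1)) ω - X (gridPoint hab D n k) ω‖ₑ ^ 2 ≤ S ω :=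
    (Finset.single_le_sum (f := fun k => ENNReal.ofReal ((ρ ^ n)⁻¹) ^ 2 *
      ‖X (gridPoint hab D n (k + 1)) ω - X (gridPoint hab D n k) ω‖ₑ ^ 2)
      (fun _ _ => zero_le) (Finset.mem_range.2 hk)).trans (ENNReal.le_tsum n)
  have h2 := ENNReal.toReal_mono hω.ne h1
  rw [ENNReal.toReal_mul, ENNReal.toReal_pow, ENNReal.toReal_pow, toReal_enorm,
    ENNReal.toReal_ofReal (by positivity), ← mul_pow] at h2
  have h3 := Real.le_sqrt_of_sq_le h2
  rw [inv_mul_le_iff₀ (by positivity), Real.norm_eq_abs] at h3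
  linarith

/-- **Kolmogorov–Chentsov theorem** on a compact interval, for second moments: one version is
Hölder continuous of all orders below the critical one, on all of `Ω`. -/
theorem exists_holder_version {P : Measure Ω} [IsProbabilityMeasure P] {a b : ℝ} (hab : a ≤ b)
    {X : Set.Icc a b → Ω → ℝ} (hX : ∀ σ, Measurable (X σ)) {M : ℝ≥0} {β : ℝ} (hβ : 1 / 2 < β)
    (hmom : ∀ τ σ, ∫⁻ ω, ‖X τ ω - X σ ω‖ₑ ^ 2 ∂P ≤
      M * ENNReal.ofReal (|(τ : ℝ) - σ| ^ β) ^ 2) :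
    ∃ Y : Set.Icc a b → Ω → ℝ, (∀ σ, Measurable (Y σ)) ∧ (∀ σ, ∀ᵐ ω ∂P, Y σ ω = X σ ω) ∧
      ∀ γ : ℝ≥0, 0 < γ → (γ : ℝ) < β - 1 / 2 →
        ∀ ω, ∃ C : ℝ≥0, HolderWith C γ (fun σ => Y σ ω) := by
  have hβ0 : 0 < β := by linarith
  -- The extra `1` keeps `D` positive when `a = b` and puts the rescaled right endpoint strictly
  -- below `1`.
  set D : ℝ := b - a + 1 with hDdef
  have hD : 0 < D := by linarith
  have hy : ∀ σ : Set.Icc a b, ((σ : ℝ) - a) / D ∈ Set.Ico (0 : ℝ) 1 := fun σ =>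
    ⟨div_nonneg (sub_nonneg.2 σ.2.1) hD.le, by rw [div_lt_one hD]; linarith [σ.2.2]⟩
  let good : ℝ → Ω → Prop := fun γ ω => ∃ A : ℝ, 0 ≤ A ∧ ∀ n k, k < 2 ^ n →
      |X (gridPoint hab D n (k + 1)) ω - X (gridPoint hab D n k) ω| ≤
        A * ((1 / 2 : ℝ) ^ γ) ^ n
  -- Countably many rational exponents give a single null set; a real `γ` is then covered by a
  -- larger rational, whose bound is stronger.
  have hgood : ∀ᵐ ω ∂P, ∀ q : ℚ, (q : ℝ) < β - 1 / 2 → good q ω := by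
    rw [ae_all_iff]
    intro q
    by_cases hq : (q : ℝ) < β - 1 / 2
    · filter_upwards [ae_exists_dyadic_increment_bound hab hX hβ0 hmom hD hq] with ω h _ using h
    · exact Eventually.of_forall fun ω h => absurd h hq
  -- The good event is shrunk to a measurable one so that cutting off outside it preserves
  -- measurability.
  obtain ⟨G, hGsub, hGm, hGP⟩ : ∃ G : Set Ω, (∀ ω ∈ G, ∀ q : ℚ, (q : ℝ) < β - 1 / 2 → good q ω) ∧
      MeasurableSet G ∧ ∀ᵐ ω ∂P, ω ∈ G := by
    obtain ⟨N, hN1, hN2, hN3⟩ := exists_measurable_superset_of_null (ae_iff.1 hgood)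
    refine ⟨Nᶜ, fun ω hω => ?_, hN2.compl, ?_⟩
    · by_contra h
      exact hω (hN1 h)
    · exact compl_mem_ae_iff.2 hN3
  have hgoodγ : ∀ ω ∈ G, ∀ γ : ℝ, γ < β - 1 / 2 → good γ ω := by
    intro ω hω γ hγ
    obtain ⟨q, hq1, hq2⟩ := exists_rat_btwn hγ
    obtain ⟨A, hA, h⟩ := hGsub ω hω q hq2
    refine ⟨A, hA, fun n k hk => (h n k hk).trans ?_⟩
    gcongr A * ?_ ^ n
    exact Real.rpow_le_rpow_of_exponent_ge (by norm_num) (by norm_num) hq1.le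
  let Z : Set.Icc a b → ℕ → Ω → ℝ := fun σ n ω =>
    X (gridPoint hab D n ⌊((σ : ℝ) - a) / D * 2 ^ n⌋₊) ω
  have hchain : ∀ ω ∈ G, ∀ γ : ℝ, 0 < γ → γ < β - 1 / 2 → ∃ (g : ℝ → ℝ) (C : ℝ), 0 ≤ C ∧
      (∀ y ∈ Set.Ico (0 : ℝ) 1,
        Tendsto (fun n => X (gridPoint hab D n ⌊y * 2 ^ n⌋₊) ω) atTop (𝓝 (g y))) ∧
      ∀ y ∈ Set.Ico (0 : ℝ) 1, ∀ w ∈ Set.Ico (0 : ℝ) 1, |g y - g w| ≤ C * |y - w| ^ γ := by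
    intro ω hω γ h0 h1
    obtain ⟨A, hA, h⟩ := hgoodγ ω hω γ h1
    exact exists_holder_limit_of_dyadic_increments (F := fun n k => X (gridPoint hab D n k) ω)
      (fun n k => by simp only [gridPoint_succ_two_mul]) hA h0 h
  have hlim : ∀ ω ∈ G, ∀ σ, ∃ l, Tendsto (fun n => Z σ n ω) atTop (𝓝 l) := by
    intro ω hω σ
    obtain ⟨g, -, -, hg, -⟩ := hchain ω hω ((β - 1 / 2) / 2) (by linarith) (by linarith)
    exact ⟨_, hg _ (hy σ)⟩
  -- The definition does not involve `γ`, so one version serves all orders; off `G` every path is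
  -- zero.
  let Y : Set.Icc a b → Ω → ℝ := fun σ => G.indicator fun ω => limUnder atTop fun n => Z σ n ω
  have hY : ∀ σ, ∀ ω ∈ G, Tendsto (fun n => Z σ n ω) atTop (𝓝 (Y σ ω)) := by
    intro σ ω hω
    simp only [Y, Set.indicator_of_mem hω]
    exact tendsto_nhds_limUnder (hlim ω hω σ)
  refine ⟨Y, fun σ => ?_, fun σ => ?_, fun γ h0 h1 ω => ?_⟩
  · refine measurable_of_tendsto_metrizable (f := fun n => G.indicator (Z σ n))
      (fun n => (hX _).indicator hGm) (tendsto_pi_nhds.2 fun ω => ?_)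
    by_cases hω : ω ∈ G
    · simpa only [Set.indicator_of_mem hω] using hY σ ω hω
    · simp only [Y, Set.indicator_of_notMem hω]
      exact tendsto_const_nhds
  -- The grid values tend to `X σ` in `L²` by the moment bound and to `Y σ` almost surely; both
  -- imply convergence in measure, whose limit is almost surely unique.
  · have hmeasure : TendstoInMeasure P (Z σ) atTop (X σ) := by
      refine tendstoInMeasure_of_tendsto_eLpNorm (p := 2) two_ne_zero
        (fun n => (hX _).aestronglyMeasurable) (hX σ).aestronglyMeasurable ?_
      have hsq : Tendsto (fun n => (M : ℝ≥0∞) * ENNReal.ofReal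
          (|(gridPoint hab D n ⌊((σ : ℝ) - a) / D * 2 ^ n⌋₊ : ℝ) - σ| ^ β) ^ 2) atTop (𝓝 0) := by
        have h2 : Tendsto (fun n => |(gridPoint hab D n ⌊((σ : ℝ) - a) / D * 2 ^ n⌋₊ : ℝ) - σ| ^ β)
            atTop (𝓝 0) := by
          have h3 := ((continuous_subtype_val.tendsto _).comp
            (tendsto_gridPoint_floor hab hD σ)).sub_const (σ : ℝ)
          rw [sub_self] at h3
          have h4 := h3.abs.rpow_const (p := β) (Or.inr hβ0.le)
          rwa [abs_zero, Real.zero_rpow hβ0.ne'] at h4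
        have h5 := ENNReal.Tendsto.const_mul (a := (M : ℝ≥0∞))
          (((ENNReal.continuous_pow 2).tendsto _).comp (ENNReal.tendsto_ofReal h2))
          (Or.inr ENNReal.coe_ne_top)
        simpa using h5
      have hsq2 := tendsto_of_tendsto_of_tendsto_of_le_of_le tendsto_const_nhds hsq
        (fun _ => zero_le) (fun n => hmom (gridPoint hab D n ⌊((σ : ℝ) - a) / D * 2 ^ n⌋₊) σ)
      have h6 := ((ENNReal.continuous_rpow_const (y := (1 / 2 : ℝ))).tendsto 0).comp hsq2
      rw [ENNReal.zero_rpow_of_pos (by norm_num)] at h6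
      refine h6.congr fun n => ?_
      rw [eLpNorm_eq_lintegral_rpow_enorm_toReal two_ne_zero ENNReal.ofNat_ne_top]
      simp [Z]
    have hmeasure2 : TendstoInMeasure P (Z σ) atTop (Y σ) := by
      refine tendstoInMeasure_of_tendsto_ae (fun n => (hX _).aestronglyMeasurable) ?_
      filter_upwards [hGP] with ω hω using hY σ ω hω
    exact tendstoInMeasure_ae_unique hmeasure2 hmeasure
  · by_cases hω : ω ∈ G
    · obtain ⟨g, C, hC, hg, hgC⟩ := hchain ω hω γ h0 h1
      have hYg : ∀ σ, Y σ ω = g (((σ : ℝ) - a) / D) := fun σ =>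
        tendsto_nhds_unique (hY σ ω hω) (hg _ (hy σ))
      refine ⟨(C / D ^ (γ : ℝ)).toNNReal, fun τ σ => ?_⟩
      have h2 := hgC _ (hy τ) _ (hy σ)
      rw [← sub_div, sub_sub_sub_cancel_right, abs_div, abs_of_pos hD,
        Real.div_rpow (abs_nonneg _) hD.le, ← mul_div_assoc, mul_div_right_comm] at h2
      change edist (Y τ ω) (Y σ ω) ≤ _
      rw [hYg, hYg, edist_dist, edist_dist, Real.dist_eq,
        ENNReal.ofReal_rpow_of_nonneg dist_nonneg γ.coe_nonneg, Subtype.dist_eq, Real.dist_eq]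
      change _ ≤ ENNReal.ofReal _ * _
      rw [← ENNReal.ofReal_mul (by positivity)]
      exact ENNReal.ofReal_le_ofReal h2
    · refine ⟨0, fun τ σ => ?_⟩
      simp only [Y, Set.indicator_of_notMem hω, edist_self]
      exact zero_le

end Kolmogorov

/-! ### Brownian increments, the Itô isometry and the Itô integral. -/

section Isometry

variable {Ω : Type*} [mΩ : MeasurableSpace Ω] {P : Measure Ω} {ℱ : Filtration ℝ≥0 mΩ}
  {W : ℝ≥0 → Ω → ℝ}

theorem IsBrownianMotion.integral_increment (hW : IsBrownianMotion W ℱ P) (s t : ℝ≥0) :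
    ∫ ω, (W t ω - W s ω) ∂P = 0 := by
  rw [integral_sub (hW.isBrownianReal.integrable_eval t) (hW.isBrownianReal.integrable_eval s),
    hW.isBrownianReal.integral_eval, hW.isBrownianReal.integral_eval, sub_zero]

theorem IsBrownianMotion.memLp_increment (hW : IsBrownianMotion W ℱ P) (s t : ℝ≥0) :
    MemLp (fun ω => W t ω - W s ω) 2 P :=
  (hW.isBrownianReal.isGaussianProcess.hasGaussianLaw_eval _).memLp_two.sub
    (hW.isBrownianReal.isGaussianProcess.hasGaussianLaw_eval _).memLp_two

theorem IsBrownianMotion.integral_increment_sq [IsProbabilityMeasure P]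
    (hW : IsBrownianMotion W ℱ P) {s t : ℝ≥0} (hst : s ≤ t) :
    ∫ ω, (W t ω - W s ω) ^ 2 ∂P = t - s := by
  have h1 : Var[fun ω => W t ω - W s ω; P] = dist (t : ℝ) s :=
    (hW.isBrownianReal.hasLaw_sub t s).variance_eq.trans variance_id_gaussianReal
  rw [variance_eq_sub (hW.memLp_increment s t), hW.integral_increment s t, Real.dist_eq,
    abs_of_nonneg (sub_nonneg.2 (by exact_mod_cast hst))] at h1
  simpa using h1

theorem IsBrownianMotion.indepFun_increment (hW : IsBrownianMotion W ℱ P) {s t : ℝ≥0}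
    (hst : s ≤ t) {f : Ω → ℝ} (hf : StronglyMeasurable[ℱ s] f) :
    IndepFun f (fun ω => W t ω - W s ω) P := by
  rw [IndepFun_iff_Indep]
  exact (indep_of_indep_of_le_right (hW.indep_increment _ _ hst) hf.measurable.comap_le).symm

/-- Independence factors the expectation and the increment is centred. Integrability of `f` is not
required, which allows `f` to be a product of coefficients and earlier increments. -/
theorem IsBrownianMotion.integral_mul_increment (hW : IsBrownianMotion W ℱ P) {s t : ℝ≥0}
    (hst : s ≤ t) {f : Ω → ℝ} (hf : StronglyMeasurable[ℱ s] f) :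
    ∫ ω, f ω * (W t ω - W s ω) ∂P = 0 := by
  rw [(hW.indepFun_increment hst hf).integral_fun_mul_eq_mul_integral
    (hf.mono (ℱ.le s)).aestronglyMeasurable (hW.memLp_increment s t).1,
    hW.integral_increment, mul_zero]

theorem IsBrownianMotion.integral_mul_increment_sq [IsProbabilityMeasure P]
    (hW : IsBrownianMotion W ℱ P) {s t : ℝ≥0} (hst : s ≤ t) {f : Ω → ℝ}
    (hf : StronglyMeasurable[ℱ s] f) :
    ∫ ω, f ω * (W t ω - W s ω) ^ 2 ∂P = (t - s) * ∫ ω, f ω ∂P := by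
  have h := (hW.indepFun_increment hst hf).comp (φ := id) (ψ := fun r : ℝ => r ^ 2)
    measurable_id (by fun_prop)
  have h2 := h.integral_fun_mul_eq_mul_integral (hf.mono (ℱ.le s)).aestronglyMeasurable
    ((hW.memLp_increment s t).1.pow 2)
  simp only [Function.comp, id] at h2
  rw [h2, hW.integral_increment_sq hst, mul_comm]

/-- A product of two `L²` functions is in general only integrable; here the squares are independent
and integrable, so their product is integrable. -/
theorem IsBrownianMotion.memLp_mul_increment (hW : IsBrownianMotion W ℱ P) {s t : ℝ≥0}
    (hst : s ≤ t) {f : Ω → ℝ} (hf : StronglyMeasurable[ℱ s] f) (hf2 : MemLp f 2 P) :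
    MemLp (fun ω => f ω * (W t ω - W s ω)) 2 P := by
  have hD := hW.memLp_increment s t
  have hind := (hW.indepFun_increment hst hf).comp (φ := fun r : ℝ => r ^ 2)
    (ψ := fun r : ℝ => r ^ 2) (by fun_prop) (by fun_prop)
  have hint := hind.integrable_mul hf2.integrable_sq hD.integrable_sq
  refine (memLp_two_iff_integrable_sq (hf2.1.mul hD.1)).2 (hint.congr ?_)
  exact Eventually.of_forall fun ω => by simp [mul_pow]

/-- The second moments of products of weighted Brownian increments. -/
theorem IsBrownianMotion.integral_mul_increment_mul_increment_of_le [IsProbabilityMeasure P]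
    (hW : IsBrownianMotion W ℱ P) {s s' r r' : ℝ≥0} (hr : r ≤ r') (hsr : s ≤ r)
    {f g : Ω → ℝ} (hf : StronglyMeasurable[ℱ s] f) (hf2 : MemLp f 2 P)
    (hg : StronglyMeasurable[ℱ r] g) (hg2 : MemLp g 2 P) :
    ∫ ω, (f ω * (W s' ω - W s ω)) * (g ω * (W r' ω - W r ω)) ∂P =
      max ((min (s' : ℝ) r') - r) 0 * ∫ ω, f ω * g ω ∂P := by
  have hfr : StronglyMeasurable[ℱ r] f := hf.mono (ℱ.mono hsr)
  have hWm : ∀ {u v : ℝ≥0}, u ≤ v → StronglyMeasurable[ℱ v] (W u) := fun h =>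
    (hW.adapted _).mono (ℱ.mono h)
  rcases le_total s' r with h | h
  · have h0 : min (s' : ℝ) r' - r ≤ 0 :=
      sub_nonpos.2 ((min_le_left _ _).trans (by exact_mod_cast h))
    rw [max_eq_right h0, zero_mul]
    have hm : StronglyMeasurable[ℱ r] fun ω => f ω * (W s' ω - W s ω) * g ω :=
      (hfr.mul ((hWm h).sub (hWm hsr))).mul hg
    rw [← hW.integral_mul_increment hr hm]
    exact integral_congr_ae (Eventually.of_forall fun ω => by ring)
  -- The intervals overlap in `[r, m]`. Splitting at `r` and `m` leaves the squared increment over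
  -- the overlap as the only product with nonzero mean; in each other product the latest increment
  -- is independent of the rest.
  · set m := min s' r' with hm
    set v := max s' r' with hv
    have hrm : r ≤ m := le_min h hr
    have hmv : m ≤ v := min_le_max
    have hm' : min (s' : ℝ) r' = m := by rw [hm, NNReal.coe_min]
    have h0 : 0 ≤ (m : ℝ) - r := sub_nonneg.2 (by exact_mod_cast hrm)
    rw [hm', max_eq_left h0]
    have hprod : ∀ ω, (W s' ω - W r ω) * (W r' ω - W r ω) =
        (W m ω - W r ω) ^ 2 + (W m ω - W r ω) * (W v ω - W m ω) := by
      intro ω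
      rcases le_total s' r' with h1 | h1
      · rw [hm, hv, min_eq_left h1, max_eq_right h1]; ring
      · rw [hm, hv, min_eq_right h1, max_eq_left h1]; ring
    have hfg : StronglyMeasurable[ℱ r] fun ω => f ω * g ω := hfr.mul hg
    have e1 : ∫ ω, (f ω * (W r ω - W s ω)) * (g ω * (W r' ω - W r ω)) ∂P = 0 := by
      have hm1 : StronglyMeasurable[ℱ r] fun ω => f ω * g ω * (W r ω - W s ω) :=
        hfg.mul ((hWm le_rfl).sub (hWm hsr))
      rw [← hW.integral_mul_increment hr hm1]
      exact integral_congr_ae (Eventually.of_forall fun ω => by ring)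
    have e2 : ∫ ω, (f ω * (W m ω - W r ω)) * (g ω * (W m ω - W r ω)) ∂P =
        (m - r) * ∫ ω, f ω * g ω ∂P := by
      rw [← hW.integral_mul_increment_sq hrm hfg]
      exact integral_congr_ae (Eventually.of_forall fun ω => by ring)
    have hgm : StronglyMeasurable[ℱ m] g := hg.mono (ℱ.mono hrm)
    have hfm : StronglyMeasurable[ℱ m] f := hfr.mono (ℱ.mono hrm)
    have e3 : ∫ ω, (f ω * (W m ω - W r ω)) * (g ω * (W v ω - W m ω)) ∂P = 0 := by
      have hm1 : StronglyMeasurable[ℱ m] fun ω => f ω * g ω * (W m ω - W r ω) :=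
        (hfm.mul hgm).mul ((hWm le_rfl).sub (hWm hrm))
      rw [← hW.integral_mul_increment hmv hm1]
      exact integral_congr_ae (Eventually.of_forall fun ω => by ring)
    have i1 := (hW.memLp_mul_increment hsr hf hf2).integrable_mul
      (hW.memLp_mul_increment hr hg hg2)
    have i2 := (hW.memLp_mul_increment hrm hfr hf2).integrable_mul
      (hW.memLp_mul_increment hrm hg hg2)
    have i3 := (hW.memLp_mul_increment hrm hfr hf2).integrable_mul
      (hW.memLp_mul_increment hmv hgm hg2)
    have hsum := integral_add' (i1.add i2) i3
    rw [integral_add' i1 i2] at hsum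
    simp only [Pi.mul_apply, Pi.add_apply] at hsum
    rw [e1, e2, e3, zero_add, add_zero] at hsum
    rw [← hsum]
    refine integral_congr_ae (Eventually.of_forall fun ω => ?_)
    have := hprod ω
    simp only
    linear_combination f ω * g ω * this

theorem IsBrownianMotion.integral_mul_increment_mul_increment [IsProbabilityMeasure P]
    (hW : IsBrownianMotion W ℱ P) {s s' r r' : ℝ≥0} (hs : s ≤ s') (hr : r ≤ r')
    {f g : Ω → ℝ} (hf : StronglyMeasurable[ℱ s] f) (hf2 : MemLp f 2 P)
    (hg : StronglyMeasurable[ℱ r] g) (hg2 : MemLp g 2 P) :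
    ∫ ω, (f ω * (W s' ω - W s ω)) * (g ω * (W r' ω - W r ω)) ∂P =
      max ((min (s' : ℝ) r') - max (s : ℝ) r) 0 * ∫ ω, f ω * g ω ∂P := by
  rcases le_total s r with h | h
  · rw [max_eq_right (show (s : ℝ) ≤ r by exact_mod_cast h)]
    exact hW.integral_mul_increment_mul_increment_of_le hr h hf hf2 hg hg2
  · rw [max_eq_left (show (r : ℝ) ≤ s by exact_mod_cast h), min_comm (s' : ℝ)]
    have := hW.integral_mul_increment_mul_increment_of_le (s' := r') hs h hg hg2 hf hf2
    simp only [mul_comm (g _)] at this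
    rw [← this]
    exact integral_congr_ae (Eventually.of_forall fun ω => by ring)

/-- The same with all increments stopped at time `t`. -/
theorem IsBrownianMotion.integral_mul_stopped_increments [IsProbabilityMeasure P]
    (hW : IsBrownianMotion W ℱ P) (t : ℝ≥0) {s s' r r' : ℝ≥0} (hs : s ≤ s') (hr : r ≤ r')
    {f g : Ω → ℝ} (hf : StronglyMeasurable[ℱ s] f) (hf2 : MemLp f 2 P)
    (hg : StronglyMeasurable[ℱ r] g) (hg2 : MemLp g 2 P) :
    ∫ ω, ((W (min s' t) ω - W (min s t) ω) * f ω) * ((W (min r' t) ω - W (min r t) ω) * g ω) ∂P =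
      max (min (min (s' : ℝ) r') t - max (s : ℝ) r) 0 * ∫ ω, f ω * g ω ∂P := by
  rcases le_total t s with h | h
  · have h1 : min (min (s' : ℝ) r') t - max (s : ℝ) r ≤ 0 :=
      sub_nonpos.2 ((min_le_right _ _).trans (le_trans (by exact_mod_cast h) (le_max_left _ _)))
    rw [max_eq_right h1, min_eq_right h, min_eq_right (h.trans hs)]
    simp
  rcases le_total t r with h' | h'
  · have h1 : min (min (s' : ℝ) r') t - max (s : ℝ) r ≤ 0 :=
      sub_nonpos.2 ((min_le_right _ _).trans (le_trans (by exact_mod_cast h') (le_max_right _ _)))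
    rw [max_eq_right h1, min_eq_right h', min_eq_right (h'.trans hr)]
    simp
  rw [min_eq_left h, min_eq_left h', inf_inf_distrib_right]
  have := hW.integral_mul_increment_mul_increment (le_min hs h) (le_min hr h') hf hf2 hg hg2
  rw [NNReal.coe_min, NNReal.coe_min] at this
  rw [← this]
  exact integral_congr_ae (Eventually.of_forall fun ω => by ring)

/-- By Fubini the time factor is the length of the overlap of the two intervals within `[0,t]`, the
same constant as in `integral_mul_stopped_increments`; this coincidence is the isometry. -/
theorem integral_indicator_mul_indicator_timeProd [IsProbabilityMeasure P] (t : ℝ≥0)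
    {s s' r r' : ℝ≥0} (f g : Ω → ℝ) :
    ∫ p : ℝ × Ω, (Set.Ico (s : ℝ) s').indicator (fun _ => f p.2) p.1 *
        (Set.Ico (r : ℝ) r').indicator (fun _ => g p.2) p.1 ∂(timeProd t P) =
      max (min (min (s' : ℝ) r') t - max (s : ℝ) r) 0 * ∫ ω, f ω * g ω ∂P := by
  have h1 : ∀ p : ℝ × Ω, (Set.Ico (s : ℝ) s').indicator (fun _ => f p.2) p.1 *
        (Set.Ico (r : ℝ) r').indicator (fun _ => g p.2) p.1 =
      (Set.Ico (s : ℝ) s' ∩ Set.Ico (r : ℝ) r').indicator (fun _ => (1 : ℝ)) p.1 *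
        (f p.2 * g p.2) := by
    intro p
    by_cases ha : p.1 ∈ Set.Ico (s : ℝ) s' <;> by_cases hb : p.1 ∈ Set.Ico (r : ℝ) r' <;>
      simp [Set.indicator, ha, hb]
  simp_rw [h1]
  rw [timeProd, integral_prod_mul
    (f := (Set.Ico (s : ℝ) s' ∩ Set.Ico (r : ℝ) r').indicator (fun _ => (1 : ℝ)))
    (g := fun ω => f ω * g ω)]
  congr 1
  rw [integral_indicator_const _ (measurableSet_Ico.inter measurableSet_Ico), smul_eq_mul, mul_one,
    ← Measure.restrict_congr_set Ico_ae_eq_Icc,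
    measureReal_restrict_apply (measurableSet_Ico.inter measurableSet_Ico),
    Set.Ico_inter_Ico, Set.Ico_inter_Ico, Real.volume_real_Ico]
  congr 2
  exact sup_eq_left.2 (le_max_of_le_left s.2)

theorem timeProd_mono [IsProbabilityMeasure P] {t T : ℝ≥0} (h : t ≤ T) :
    timeProd t P ≤ timeProd T P := by
  unfold timeProd
  exact Measure.prod_mono (Measure.restrict_mono (Set.Icc_subset_Icc_right (by exact_mod_cast h))
    le_rfl) le_rfl

/-- Restriction of `L²([0,T] × Ω)` to `L²([0,t] × Ω)`. -/
noncomputable def restrictTime [IsProbabilityMeasure P] {t T : ℝ≥0} (h : t ≤ T)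
    (f : Lp ℝ 2 (timeProd T P)) : Lp ℝ 2 (timeProd t P) :=
  ((Lp.memLp f).mono_measure (timeProd_mono h)).toLp f

theorem coeFn_restrictTime [IsProbabilityMeasure P] {t T : ℝ≥0} (h : t ≤ T)
    (f : Lp ℝ 2 (timeProd T P)) : restrictTime h f =ᵐ[timeProd t P] f :=
  MemLp.coeFn_toLp _

theorem norm_restrictTime_sub_le [IsProbabilityMeasure P] {t T : ℝ≥0} (h : t ≤ T)
    (f g : Lp ℝ 2 (timeProd T P)) : ‖restrictTime h f - restrictTime h g‖ ≤ ‖f - g‖ := by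
  unfold restrictTime
  rw [← MemLp.toLp_sub, Lp.norm_toLp, Lp.norm_def]
  refine ENNReal.toReal_mono (Lp.eLpNorm_ne_top _) ?_
  rw [eLpNorm_congr_ae (Lp.coeFn_sub f g)]
  exact eLpNorm_mono_measure _ (timeProd_mono h)

theorem continuous_restrictTime [IsProbabilityMeasure P] {t T : ℝ≥0} (h : t ≤ T) :
    Continuous (restrictTime (P := P) h) := by
  refine LipschitzWith.continuous (K := 1) (LipschitzWith.of_dist_le_mul fun f g => ?_)
  rw [dist_eq_norm, dist_eq_norm, NNReal.coe_one, one_mul]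
  exact norm_restrictTime_sub_le h f g

theorem inner_toLp_toLp {S : Type*} [MeasurableSpace S] {μ : Measure S} {f g : S → ℝ}
    (hf : MemLp f 2 μ) (hg : MemLp g 2 μ) :
    inner ℝ (hf.toLp f) (hg.toLp g) = ∫ s, f s * g s ∂μ := by
  rw [L2.inner_def]
  refine integral_congr_ae ?_
  filter_upwards [hf.coeFn_toLp, hg.coeFn_toLp] with s h1 h2
  simp [h1, h2, mul_comm]

/-! ### The isometry for elementary processes. -/

namespace ElementaryProcess

variable {K : Type*} [MetricSpace K] [CompactSpace K] {T : ℝ≥0}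

theorem memLp_indicator_coeff [IsProbabilityMeasure P] (u : ElementaryProcess K ℱ P T) (t : ℝ≥0)
    (k : K) (i : Fin (u.n + 1)) :
    MemLp (fun p : ℝ × Ω => (Set.Ico (u.time i.castSucc : ℝ) (u.time i.succ)).indicator
      (fun _ => u.coeff i p.2 k) p.1) 2 (timeProd t P) := by
  have h1 : MemLp (fun p : ℝ × Ω => u.coeff i p.2 k) 2 (timeProd t P) :=
    (memLp_eval (u.coeff_memLp i) k).comp_snd
      ((volume : Measure ℝ).restrict (Set.Icc 0 (t : ℝ)))
  exact memLp_indicator_aux (measurable_fst measurableSet_Ico) h1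

theorem stronglyMeasurable_coeff_eval (u : ElementaryProcess K ℱ P T) (k : K)
    (i : Fin (u.n + 1)) :
    StronglyMeasurable[ℱ (u.time i.castSucc)] fun ω => u.coeff i ω k :=
  (continuous_eval_const (F := C(K, ℝ)) k).comp_stronglyMeasurable (u.coeff_meas i)

theorem memLp_stopped_increment_mul_coeff (hW : IsBrownianMotion W ℱ P)
    (u : ElementaryProcess K ℱ P T) (t : ℝ≥0) (k : K) (i : Fin (u.n + 1)) :
    MemLp (fun ω => (W (min (u.time i.succ) t) ω - W (min (u.time i.castSucc) t) ω) *
      u.coeff i ω k) 2 P := by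
  have hle : u.time i.castSucc ≤ u.time i.succ := u.time_mono (Fin.castSucc_le_succ i)
  rcases le_total t (u.time i.castSucc) with h | h
  · rw [min_eq_right h, min_eq_right (h.trans hle)]
    simp only [sub_self, zero_mul]
    exact memLp_const_zero
  · rw [min_eq_left h]
    have := hW.memLp_mul_increment (le_min hle h) (u.stronglyMeasurable_coeff_eval k i)
      (memLp_eval (u.coeff_memLp i) k)
    simpa only [mul_comm] using this

theorem restrictTime_field_apply [IsProbabilityMeasure P] (u : ElementaryProcess K ℱ P T)
    {t : ℝ≥0} (h : t ≤ T) (k : K) :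
    restrictTime h (u.field k) = ∑ i, (u.memLp_indicator_coeff t k i).toLp _ := by
  apply Lp.ext
  have h1 : u.field k =ᵐ[timeProd t P] fun p => u.toFun p k :=
    (timeProd_mono h).absolutelyContinuous.ae_le (MemLp.coeFn_toLp (memLp_eval u.memLp_toFun k))
  have h2 : ∀ᵐ p ∂(timeProd t P), ∀ i, (u.memLp_indicator_coeff t k i).toLp _ p =
      (Set.Ico (u.time i.castSucc : ℝ) (u.time i.succ)).indicator (fun _ => u.coeff i p.2 k) p.1 :=
    ae_all_iff.2 fun i => MemLp.coeFn_toLp _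
  filter_upwards [coeFn_restrictTime h (u.field k), h1, h2,
    Lp.coeFn_finsetSum Finset.univ fun i => (u.memLp_indicator_coeff t k i).toLp _]
    with p e1 e2 e3 e4
  rw [e1, e2, e4]
  simp only [Finset.sum_apply, e3, toFun, ContinuousMap.coe_sum]
  refine Finset.sum_congr rfl fun i _ => ?_
  by_cases hp : p.1 ∈ Set.Ico (u.time i.castSucc : ℝ) (u.time i.succ)
  · simp only [Set.indicator_of_mem hp]
  · simp only [Set.indicator_of_notMem hp, ContinuousMap.zero_apply]

theorem integral_apply (hW : IsBrownianMotion W ℱ P) (u : ElementaryProcess K ℱ P T)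
    (t : ℝ≥0) (k : K) :
    u.integral hW t k = ∑ i, (u.memLp_stopped_increment_mul_coeff hW t k i).toLp _ := by
  apply Lp.ext
  have h1 : u.integral hW t k =ᵐ[P] fun ω => u.integralFun W t ω k :=
    MemLp.coeFn_toLp (memLp_eval (u.memLp_integralFun hW t) k)
  have h2 : ∀ᵐ ω ∂P, ∀ i, (u.memLp_stopped_increment_mul_coeff hW t k i).toLp _ ω =
      (W (min (u.time i.succ) t) ω - W (min (u.time i.castSucc) t) ω) * u.coeff i ω k :=
    ae_all_iff.2 fun i => MemLp.coeFn_toLp _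
  filter_upwards [h1, h2,
    Lp.coeFn_finsetSum Finset.univ fun i => (u.memLp_stopped_increment_mul_coeff hW t k i).toLp _]
    with ω e2 e3 e4
  rw [e2, e4]
  simp only [Finset.sum_apply, e3, integralFun, ContinuousMap.coe_sum, ContinuousMap.coe_smul,
    Pi.smul_apply, smul_eq_mul]

/-- The Itô isometry in polarized form, across elementary processes and points of `K`. -/
theorem inner_integral_integral [IsProbabilityMeasure P] (hW : IsBrownianMotion W ℱ P)
    (u v : ElementaryProcess K ℱ P T) {t : ℝ≥0} (h : t ≤ T) (k l : K) :
    inner ℝ (u.integral hW t k) (v.integral hW t l) =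
      inner ℝ (restrictTime h (u.field k)) (restrictTime h (v.field l)) := by
  rw [integral_apply, integral_apply, restrictTime_field_apply, restrictTime_field_apply]
  simp only [sum_inner, inner_sum]
  refine Finset.sum_congr rfl fun j _ => Finset.sum_congr rfl fun i _ => ?_
  rw [inner_toLp_toLp, inner_toLp_toLp, integral_indicator_mul_indicator_timeProd t
    (fun ω => u.coeff i ω k) (fun ω => v.coeff j ω l)]
  exact hW.integral_mul_stopped_increments t (u.time_mono (Fin.castSucc_le_succ _))
    (v.time_mono (Fin.castSucc_le_succ _)) (u.stronglyMeasurable_coeff_eval k _)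
    (memLp_eval (u.coeff_memLp _) k) (v.stronglyMeasurable_coeff_eval l _)
    (memLp_eval (v.coeff_memLp _) l)

/-- The Itô isometry for differences. -/
theorem norm_integral_sub_integral [IsProbabilityMeasure P] (hW : IsBrownianMotion W ℱ P)
    (u v : ElementaryProcess K ℱ P T) {t : ℝ≥0} (h : t ≤ T) (k l : K) :
    ‖u.integral hW t k - v.integral hW t l‖ =
      ‖restrictTime h (u.field k) - restrictTime h (v.field l)‖ := by
  rw [← sq_eq_sq₀ (norm_nonneg _) (norm_nonneg _), @norm_sub_sq_real, @norm_sub_sq_real,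
    ← real_inner_self_eq_norm_sq, ← real_inner_self_eq_norm_sq, ← real_inner_self_eq_norm_sq,
    ← real_inner_self_eq_norm_sq]
  simp only [inner_integral_integral hW _ _ h]

/-- The isometry at each single point of `K`, followed by the loss of `[t,T]`, makes integration
nonexpansive; this is what carries it to the closure. -/
theorem dist_integral_le [IsProbabilityMeasure P] (hW : IsBrownianMotion W ℱ P)
    (u v : ElementaryProcess K ℱ P T) {t : ℝ≥0} (h : t ≤ T) :
    dist (u.integral hW t) (v.integral hW t) ≤ dist u.field v.field := by
  rw [ContinuousMap.dist_le dist_nonneg]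
  intro k
  rw [dist_eq_norm, norm_integral_sub_integral hW u v h]
  refine (norm_restrictTime_sub_le h _ _).trans ?_
  rw [← dist_eq_norm]
  exact ContinuousMap.dist_apply_le_dist k

/-- Terms starting after `t` vanish, since both stopped times equal `t`; the remaining coefficients
are measurable at time `t`. -/
theorem integral_mem_integralSpace (hW : IsBrownianMotion W ℱ P)
    (u : ElementaryProcess K ℱ P T) (t : ℝ≥0) : u.integral hW t ∈ integralSpace K ℱ P t := by
  refine subset_closure ⟨u.integralFun W t, u.memLp_integralFun hW t, ?_, rfl⟩
  have hterm : ∀ i ∈ (Finset.univ : Finset (Fin (u.n + 1))), StronglyMeasurable[ℱ t] fun ω =>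
      (W (min (u.time i.succ) t) ω - W (min (u.time i.castSucc) t) ω) • u.coeff i ω := by
    intro i _
    have hle : u.time i.castSucc ≤ u.time i.succ := u.time_mono (Fin.castSucc_le_succ i)
    rcases le_total t (u.time i.castSucc) with h | h
    · rw [min_eq_right h, min_eq_right (h.trans hle)]
      simp only [sub_self, zero_smul]
      exact stronglyMeasurable_const
    · have hWm : ∀ r, StronglyMeasurable[ℱ t] (W (min r t)) := fun r =>
        (hW.adapted _).mono (ℱ.mono (min_le_right _ _))
      exact ((hWm _).sub (hWm _)).smul ((u.coeff_meas i).mono (ℱ.mono h))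
  exact Finset.stronglyMeasurable_fun_sum _ hterm

end ElementaryProcess

/-- Existence of the Itô integral, with the isometry for spatial increments. -/
theorem exists_isItoIntegral {K : Type*} [MetricSpace K] [CompactSpace K]
    [IsProbabilityMeasure P] (hW : IsBrownianMotion W ℱ P) {t T : ℝ≥0} (h : t ≤ T)
    {x : C(K, Lp ℝ 2 (timeProd T P))} (hx : x ∈ integrands K ℱ P T) :
    ∃ z : C(K, Lp ℝ 2 P), IsItoIntegral hW x t z ∧
      ∀ k l, ‖z k - z l‖ = ‖restrictTime h (x k) - restrictTime h (x l)‖ := by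
  obtain ⟨f, hf, hfx⟩ := mem_closure_iff_seq_limit.1 hx
  choose u hu using hf
  have hux : Tendsto (fun n => (u n).field) atTop (𝓝 x) := by
    simpa only [hu] using hfx
  have hcauchy : CauchySeq fun n => (u n).integral hW t := by
    rw [Metric.cauchySeq_iff]
    intro ε hε
    obtain ⟨N, hN⟩ := Metric.cauchySeq_iff.1 hux.cauchySeq ε hε
    exact ⟨N, fun m hm n hn =>
      (ElementaryProcess.dist_integral_le hW _ _ h).trans_lt (hN m hm n hn)⟩
  obtain ⟨z, hz⟩ := cauchySeq_tendsto_of_complete hcauchy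
  refine ⟨z, ⟨hx, ?_, fun v hv => ?_⟩, fun k l => ?_⟩
  · exact isClosed_closure.mem_of_tendsto hz
      (Eventually.of_forall fun n => (u n).integral_mem_integralSpace hW t)
  -- Two sequences with the same limit integrand have integrals whose distance tends to zero.
  · have hd : Tendsto (fun n => dist ((u n).integral hW t) ((v n).integral hW t)) atTop (𝓝 0) := by
      have h0 := hux.dist hv
      rw [dist_self] at h0
      exact squeeze_zero (fun _ => dist_nonneg)
        (fun n => ElementaryProcess.dist_integral_le hW (u n) (v n) h) h0
    exact (tendsto_iff_of_dist hd).1 hz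
  · have hI : ∀ k, Tendsto (fun n => (u n).integral hW t k) atTop (𝓝 (z k)) := fun k =>
      ((continuous_eval_const k).tendsto _).comp hz
    have h1 := ((hI k).sub (hI l)).norm
    have hr : ∀ k, Tendsto (fun n => restrictTime h ((u n).field k)) atTop
        (𝓝 (restrictTime h (x k))) := fun k =>
      ((continuous_restrictTime h).tendsto _).comp
        (((continuous_eval_const k).tendsto _).comp hux)
    have h2 := ((hr k).sub (hr l)).norm
    refine tendsto_nhds_unique h1 (h2.congr fun n => ?_)
    exact (ElementaryProcess.norm_integral_sub_integral hW _ _ h k l).symm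

theorem IsItoIntegral.unique {K : Type*} [MetricSpace K] [CompactSpace K]
    [IsProbabilityMeasure P] {hW : IsBrownianMotion W ℱ P} {t T : ℝ≥0}
    {x : C(K, Lp ℝ 2 (timeProd T P))} {z z' : C(K, Lp ℝ 2 P)} (hz : IsItoIntegral hW x t z)
    (hz' : IsItoIntegral hW x t z') : z' = z := by
  obtain ⟨f, hf, hfx⟩ := mem_closure_iff_seq_limit.1 hz.mem_integrands
  choose u hu using hf
  have hux : Tendsto (fun n => (u n).field) atTop (𝓝 x) := by
    simpa only [hu] using hfx
  exact tendsto_nhds_unique (hz'.tendsto_integral u hux) (hz.tendsto_integral u hux)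

/-- A pathwise Hölder bound on the integrand bounds the `L²` increments over `[0,t]`. -/
theorem enorm_restrictTime_sub_le [IsProbabilityMeasure P] {t T : ℝ≥0} (h : t ≤ T)
    {f g : Lp ℝ 2 (timeProd T P)} {L : Ω → ℝ} (hL : AEStronglyMeasurable L P) {c : ℝ}
    (hfg : ∀ᵐ p ∂(timeProd t P), |f p - g p| ≤ L p.2 * c) :
    ‖restrictTime h f - restrictTime h g‖ₑ ^ 2 ≤
      t * eLpNorm L 2 P ^ 2 * ENNReal.ofReal |c| ^ 2 := by
  have hsq : ∀ {S : Type _} [MeasurableSpace S] (μ : Measure S) (φ : S → ℝ),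
      eLpNorm φ 2 μ ^ 2 = ∫⁻ s, ‖φ s‖ₑ ^ 2 ∂μ := by
    intro S _ μ φ
    simpa using eLpNorm_nnreal_pow_eq_lintegral (f := φ) (μ := μ) (p := 2) two_ne_zero
  unfold restrictTime
  rw [← MemLp.toLp_sub, Lp.enorm_toLp, hsq]
  have hLsnd : ∫⁻ p, ‖L p.2‖ₑ ^ 2 ∂(timeProd t P) = t * eLpNorm L 2 P ^ 2 := by
    rw [timeProd, lintegral_prod _ ((hL.comp_snd).enorm.pow_const 2), hsq]
    simp [mul_comm]
  calc ∫⁻ p, ‖(f - g : ℝ × Ω → ℝ) p‖ₑ ^ 2 ∂(timeProd t P)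
      ≤ ∫⁻ p, ‖L p.2‖ₑ ^ 2 * ENNReal.ofReal |c| ^ 2 ∂(timeProd t P) := by
        refine lintegral_mono_ae ?_
        filter_upwards [hfg] with p hp
        rw [← mul_pow, ← Real.enorm_eq_ofReal_abs, ← enorm_mul]
        gcongr
        rw [enorm_le_iff_norm_le, Real.norm_eq_abs, Real.norm_eq_abs]
        exact hp.trans (le_abs_self _)
    _ = _ := by
        rw [lintegral_mul_const' _ _ (by simp), hLsnd]

end Isometry

end SpatialIto

theorem proposition5p3 {Ω : Type*} [mΩ : MeasurableSpace Ω] {P : Measure Ω}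
    [IsProbabilityMeasure P] {ℱ : Filtration ℝ≥0 mΩ} {W : ℝ≥0 → Ω → ℝ}
    (hW : SpatialIto.IsBrownianMotion W ℱ P)
    {a b : ℝ} (hab : a ≤ b) {T t : ℝ≥0} (htT : t ≤ T)
    (x : C(Set.Icc a b, Lp ℝ 2 (SpatialIto.timeProd T P)))
    (hx : x ∈ SpatialIto.integrands (Set.Icc a b) ℱ P T)
    {β : ℝ} (hβ : 1 / 2 < β) {L : Ω → ℝ} (hL : MemLp L 2 P)
    (hxL : ∀ τ σ : Set.Icc a b, ∀ᵐ p ∂(SpatialIto.timeProd t P),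
      |x τ p - x σ p| ≤ L p.2 * |(τ : ℝ) - (σ : ℝ)| ^ β) :
    ∃ z : C(Set.Icc a b, Lp ℝ 2 P),
      SpatialIto.IsItoIntegral hW x t z ∧
      (∀ z' : C(Set.Icc a b, Lp ℝ 2 P), SpatialIto.IsItoIntegral hW x t z' → z' = z) ∧
      ∃ Y : Set.Icc a b → Ω → ℝ,
        (∀ σ, Measurable (Y σ)) ∧
        (∀ σ, ∀ᵐ ω ∂P, Y σ ω = z σ ω) ∧
        ∀ γ : ℝ≥0, 0 < γ → (γ : ℝ) < β - 1 / 2 →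
          ∀ ω, ∃ C : ℝ≥0, HolderWith C γ (fun σ => Y σ ω) := by
  obtain ⟨z, hz, hiso⟩ := SpatialIto.exists_isItoIntegral hW htT hx
  refine ⟨z, hz, fun z' hz' => hz.unique hz', ?_⟩
  have hLtop : (t : ℝ≥0∞) * eLpNorm L 2 P ^ 2 ≠ ∞ :=
    ENNReal.mul_ne_top ENNReal.coe_ne_top (ENNReal.pow_ne_top hL.eLpNorm_ne_top)
  -- The moment constant is `t E[L²]`. The exceptional sets in `hxL` may vary with `τ` and `σ`,
  -- because only second moments of individual increments enter.
  refine SpatialIto.exists_holder_version hab (X := fun σ => z σ)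
    (M := ((t : ℝ≥0∞) * eLpNorm L 2 P ^ 2).toNNReal)
    (fun σ => (Lp.stronglyMeasurable (z σ)).measurable) hβ fun τ σ => ?_
  rw [ENNReal.coe_toNNReal hLtop]
  have h1 := SpatialIto.enorm_restrictTime_sub_le htT hL.1 (hxL τ σ)
  rw [abs_of_nonneg (Real.rpow_nonneg (abs_nonneg _) β)] at h1
  have h2 : ‖z τ - z σ‖ₑ =
      ‖SpatialIto.restrictTime htT (x τ) - SpatialIto.restrictTime htT (x σ)‖ₑ := by
    rw [← ofReal_norm, ← ofReal_norm, hiso]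
  have h3 : ∫⁻ ω, ‖z τ ω - z σ ω‖ₑ ^ 2 ∂P = ‖z τ - z σ‖ₑ ^ 2 := by
    rw [Lp.enorm_def, eLpNorm_congr_ae (Lp.coeFn_sub (z τ) (z σ))]
    have := eLpNorm_nnreal_pow_eq_lintegral (f := ⇑(z τ) - ⇑(z σ)) (μ := P) (p := 2) two_ne_zero
    simpa using this.symm
  rw [h3, h2]
  exact h1
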